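/- Let $X = (X,d)$ be a metric space. For $x,y,z \in X$, write $x \preceq y \preceq z$ if $d(x,z) = d(x,y) + d(y,z)$, and say that $y$ is strictly between $x$ and $z$, written $x \prec y \prec z$, if moreover $x \neq y \neq z$. Put $[a,b] = \{x \in X : a \preceq x \preceq b\}$. The space $X$ is aligned if $$[x_0,x_n] = [x_0,x_1] \cup [x_1,x_2] \cup \cdots \cup [x_{n-1},x_n]$$ for all $n \geq 1$ and $x_0,\ldots,x_n \in X$ such that $x_{i-1} \prec x_i \prec x_{i+1}$ whenever $0 < i < n$. Two points of $X$ are adjacent if they are distinct and no point of $X$ is strictly between them; the inner boundary $\rho X$ is the set of points of $X$ that are adjacent to some point of $X$. A map of metric spaces is a function $f$ with $d(f(x),f(x')) \leq d(x,x')$ for all $x,x'$. For $n \geq 0$ and real $\ell \geq 0$, let $MC_{n,\ell}(X)$ be the free abelian group on the tuples $(x_0,\ldots,x_n)$ in $X$ with $x_{i-1} \neq x_i$ for $1 \leq i \leq n$ and length $d(x_0,x_1) + \cdots + d(x_{n-1},x_n) = \ell$. These groups form a chain complex $MC_{*,\ell}(X)$ with boundary map $\partial = \sum_{i=0}^{n}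 (-1)^i \partial^i$ in degree $n \geq 1$ (and $\partial = 0$ in degree $0$), where $\partial^i(x_0,\ldots,x_n)$ is the tuple with $x_i$ removed if that tuple still has length $\ell$, and $0$ otherwise. The magnitude homology $MH_{n,\ell}(X)$ is its $n$th homology group, and $MH_n(X) = \bigoplus_{\ell \geq 0} MH_{n,\ell}(X)$. A map $f : X \to Y$ induces a homomorphism $f_* : MH_n(X) \to MH_n(Y)$ through the chain maps that send $(x_0,\ldots,x_n)$ to $(f(x_0),\ldots,f(x_n))$ if this is a generator of $MC_{n,\ell}(Y)$, and to $0$ otherwise. **Proposition.** Let $X$ be an aligned metric space and $e : X \to X$ a map of metric spaces. The following are equivalent: 1. $e_* : MH_n(X) \to MH_n(X)$ is the identity for all $n \geq 1$; 2. $e_* : MH_n(X) \to MH_n(X)$ is the identity for some $n \geq 1$; 3. $e(x) = x$ for all $x \in \rho X$. -/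

import Mathlib

open scoped NNReal

namespace MagnitudeHomology

universe u v

set_option linter.unusedSectionVars false

/-! ### Metric notions -/

section Metric

variable {X : Type u} [MetricSpace X] {Y : Type v} [MetricSpace Y]

/-- A map of metric spaces: a distance-decreasing function. -/
def IsMap (f : X → Y) : Prop := ∀ x x' : X, dist (f x) (f x') ≤ dist x x'

/-- `x ≼ y ≼ z`: the point `y` is between `x` and `z`. -/
def Between (x y z : X) : Prop := dist x z = dist x y + dist y z

/-- `x ≺ y ≺ z`: the point `y` is strictly between `x` and `z`. -/
def StrictlyBetween (x y z : X) : Prop := Between x y z ∧ x ≠ y ∧ y ≠ z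

/-- The closed interval `[a, b]` of a metric space. -/
def closedInterval (a b : X) : Set X := {x | Between a x b}

variable (X) in
/-- A metric space is aligned if `[x₀, xₙ] = [x₀, x₁] ∪ ⋯ ∪ [xₙ₋₁, xₙ]` for every tuple
`x₀, …, xₙ` with `n ≥ 1` in which each inner entry is strictly between its two neighbours. -/
def IsAligned : Prop :=
  ∀ (n : ℕ) (x : Fin (n + 1) → X), 1 ≤ n →
    (∀ (i : ℕ) (hi : i + 2 < n + 1),
      StrictlyBetween (x ⟨i, by omega⟩) (x ⟨i + 1, by omega⟩) (x ⟨i + 2, hi⟩)) →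
    closedInterval (x 0) (x (Fin.last n)) =
      ⋃ i : Fin n, closedInterval (x i.castSucc) (x i.succ)

/-- Two points are adjacent if they are distinct and no point is strictly between them. -/
def Adjacent (x y : X) : Prop := x ≠ y ∧ ¬ ∃ z : X, StrictlyBetween x z y

variable (X) in
/-- The inner boundary: the points that are adjacent to some point. -/
def innerBoundary : Set X := {x | ∃ y : X, Adjacent x y}

end Metric

/-! ### Tuples, their lengths, proper chains -/

section Chains

variable {X : Type u} [MetricSpace X] {Y : Type v} [MetricSpace Y]

/-- The length `d(x₀, x₁) + ⋯ + d(xₙ₋₁, xₙ)` of a tuple. -/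
def length {n : ℕ} (x : Fin (n + 1) → X) : ℝ :=
  ∑ i : Fin n, dist (x i.castSucc) (x i.succ)

/-- A tuple is proper if consecutive entries are distinct. -/
def IsProper {n : ℕ} (x : Fin (n + 1) → X) : Prop :=
  ∀ i : Fin n, x i.castSucc ≠ x i.succ

variable (X) in
/-- The set of proper chains of degree `n` and length `ℓ`. -/
abbrev ProperChain (n : ℕ) (ℓ : ℝ≥0) : Type u :=
  {x : Fin (n + 1) → X // IsProper x ∧ length x = ℓ}

/-- The tuple with its `i`th entry removed. -/
def remove {n : ℕ} (x : Fin (n + 2) → X) (i : Fin (n + 2)) : Fin (n + 1) → X :=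
  fun j => x (i.succAbove j)

theorem length_succ {n : ℕ} (x : Fin (n + 2) → X) :
    length x = dist (x 0) (x 1) + length (fun j => x j.succ) := by
  unfold length
  rw [Fin.sum_univ_succ]
  rfl

theorem isProper_succ {n : ℕ} (x : Fin (n + 2) → X) :
    IsProper x ↔ x 0 ≠ x 1 ∧ IsProper (fun j => x j.succ) := by
  unfold IsProper
  rw [Fin.forall_fin_succ]
  rfl

theorem length_nonneg {n : ℕ} (x : Fin (n + 1) → X) : 0 ≤ length x :=
  Finset.sum_nonneg fun _ _ => dist_nonneg

theorem tail_remove_succ {n : ℕ} (x : Fin (n + 3) → X) (i : Fin (n + 2)) :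
    (fun j : Fin (n + 1) => remove x i.succ j.succ) = remove (fun j => x j.succ) i := by
  funext j
  simp [remove]

/-- Removing an entry does not increase the length. -/
theorem length_remove_le {n : ℕ} (x : Fin (n + 2) → X) (i : Fin (n + 2)) :
    length (remove x i) ≤ length x := by
  induction n with
  | zero =>
    have h : length (remove x i) = 0 := by simp [length]
    rw [h]
    exact length_nonneg x
  | succ n ih =>
    refine Fin.cases ?_ (fun i => ?_) i
    · have h : remove x 0 = fun j => x j.succ := by
        funext j
        simp [remove]
      rw [h, length_succ x]
      linarith [dist_nonneg (x := x 0) (y := x 1)]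
    · rw [length_succ (remove x i.succ), tail_remove_succ, length_succ x]
      refine Fin.cases ?_ (fun i => ?_) i
      · have h : remove (fun j => x j.succ) 0 = fun j => x j.succ.succ := by
          funext j
          simp [remove]
        have h0 : remove x (Fin.succ 0) 0 = x 0 := rfl
        have h1 : remove x (Fin.succ 0) 1 = x 2 := rfl
        rw [h, h0, h1, length_succ (fun j => x j.succ)]
        have h2 := dist_triangle (x 0) (x 1) (x 2)
        have h3 : dist (x (Fin.succ 0)) (x (Fin.succ 1)) = dist (x 1) (x 2) := rfl
        linarith
      · have h0 : remove x i.succ.succ 0 = x 0 := rfl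
        have h1 : remove x i.succ.succ 1 = x 1 := by
          change x (i.succ.succ.succAbove (Fin.succ 0)) = x 1
          rw [Fin.succ_succAbove_succ, Fin.succ_succAbove_zero]
          rfl
        rw [h0, h1]
        linarith [ih (fun j => x j.succ) i.succ]

/-- Removing an entry of a proper tuple without changing the length gives a proper tuple. -/
theorem isProper_remove {n : ℕ} (x : Fin (n + 2) → X) (i : Fin (n + 2)) (hx : IsProper x)
    (h : length (remove x i) = length x) : IsProper (remove x i) := by
  induction n with
  | zero => exact fun j => j.elim0
  | succ n ih =>
    rw [isProper_succ] at hx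
    revert h
    refine Fin.cases ?_ (fun i => ?_) i
    · intro _
      have h : remove x 0 = fun j => x j.succ := by
        funext j
        simp [remove]
      rw [h]
      exact hx.2
    · intro h
      rw [length_succ (remove x i.succ), tail_remove_succ, length_succ x] at h
      rw [isProper_succ, tail_remove_succ]
      revert h
      refine Fin.cases ?_ (fun i => ?_) i
      · intro h
        have e : remove (fun j => x j.succ) 0 = fun j => x j.succ.succ := by
          funext j
          simp [remove]
        have h0 : remove x (Fin.succ 0) 0 = x 0 := rfl
        have h1 : remove x (Fin.succ 0) 1 = x 2 := rfl
        rw [e, h0, h1, length_succ (fun j => x j.succ)] at h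
        have h3 : dist (x (Fin.succ 0)) (x (Fin.succ 1)) = dist (x 1) (x 2) := rfl
        have h4 : 0 < dist (x 0) (x 1) := dist_pos.2 hx.1
        refine ⟨?_, ?_⟩
        · rw [h0, h1]
          refine dist_pos.1 ?_
          linarith [dist_nonneg (x := x 1) (y := x 2)]
        · rw [e]
          exact ((isProper_succ _).1 hx.2).2
      · intro h
        have h0 : remove x i.succ.succ 0 = x 0 := rfl
        have h1 : remove x i.succ.succ 1 = x 1 := by
          change x (i.succ.succ.succAbove (Fin.succ 0)) = x 1
          rw [Fin.succ_succAbove_succ, Fin.succ_succAbove_zero]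
          rfl
        rw [h0, h1] at h ⊢
        exact ⟨hx.1, ih (fun j => x j.succ) i.succ hx.2 (by linarith)⟩

theorem length_map_le {f : X → Y} (hf : IsMap f) {n : ℕ} (x : Fin (n + 1) → X) :
    length (f ∘ x) ≤ length x :=
  Finset.sum_le_sum fun _ _ => hf _ _

theorem isProper_map {f : X → Y} (hf : IsMap f) {n : ℕ} (x : Fin (n + 1) → X)
    (hx : IsProper x) (h : length (f ∘ x) = length x) : IsProper (f ∘ x) := by
  intro i
  have h1 := (Finset.sum_eq_sum_iff_of_le (s := Finset.univ)
    (fun (i : Fin n) _ => hf (x i.castSucc) (x i.succ))).1 h i (Finset.mem_univ i)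
  refine dist_pos.1 ?_
  exact lt_of_lt_of_eq (dist_pos.2 (hx i)) h1.symm

theorem remove_remove {n : ℕ} (x : Fin (n + 3) → X) (i : Fin (n + 3)) (j : Fin (n + 2)) :
    remove (remove x (i.succAbove j)) (j.predAbove i) = remove (remove x i) j := by
  funext k
  simp only [remove]
  rw [Fin.succAbove_succAbove_succAbove_predAbove]

end Chains

/-! ### The magnitude chain complex and magnitude homology -/

noncomputable section Complex

open CategoryTheory

variable (X : Type u) [MetricSpace X] {Y : Type u} [MetricSpace Y]

/-- The free abelian group on the proper chains of degree `n` and length `ℓ`. -/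
abbrev MC (n : ℕ) (ℓ : ℝ≥0) : Type u := ProperChain X n ℓ →₀ ℤ

variable {X}

open Classical in
/-- The `i`th face of a proper chain: remove the `i`th entry if this does not change the length;
otherwise the face is zero. -/
def face {n : ℕ} {ℓ : ℝ≥0} (i : Fin (n + 2)) (x : ProperChain X (n + 1) ℓ) : MC X n ℓ :=
  if h : length (remove x.1 i) = ℓ then
    Finsupp.single ⟨remove x.1 i, isProper_remove x.1 i x.2.1 (h.trans x.2.2.symm), h⟩ 1
  else 0

variable (X) in
/-- The boundary map `∂ = ∑ᵢ (-1)ⁱ ∂ⁱ` from degree `n + 1` to degree `n`. -/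
def boundary (n : ℕ) (ℓ : ℝ≥0) : MC X (n + 1) ℓ →ₗ[ℤ] MC X n ℓ :=
  Finsupp.linearCombination ℤ fun x => ∑ i : Fin (n + 2), (-1 : ℤ) ^ (i : ℕ) • face i x

open Classical in
/-- The image of a proper chain under a function, or zero if this is not a proper chain of the
same length. -/
def push (f : X → Y) {n : ℕ} {ℓ : ℝ≥0} (x : ProperChain X n ℓ) : MC Y n ℓ :=
  if h : IsProper (f ∘ x.1) ∧ length (f ∘ x.1) = ℓ then Finsupp.single ⟨f ∘ x.1, h⟩ 1 else 0

/-- The homomorphism `f_#` in degree `n` and length `ℓ`. -/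
def chainMap (f : X → Y) (n : ℕ) (ℓ : ℝ≥0) : MC X n ℓ →ₗ[ℤ] MC Y n ℓ :=
  Finsupp.linearCombination ℤ (push f)

open Classical in
/-- An auxiliary function for the next proofs: a tuple as a generator, or zero if it is not a
proper chain of length `ℓ`. -/
def gen {n : ℕ} (ℓ : ℝ≥0) (x : Fin (n + 1) → X) : MC X n ℓ :=
  if h : IsProper x ∧ length x = ℓ then Finsupp.single ⟨x, h⟩ 1 else 0

theorem gen_val {n : ℕ} {ℓ : ℝ≥0} (x : ProperChain X n ℓ) :
    gen ℓ x.1 = Finsupp.single x 1 := by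
  unfold gen
  rw [dif_pos x.2]

theorem gen_of_lt {n : ℕ} {ℓ : ℝ≥0} (x : Fin (n + 1) → X) (h : length x < ℓ) :
    gen ℓ x = 0 := by
  unfold gen
  rw [dif_neg fun h' => h.ne h'.2]

theorem face_eq_gen {n : ℕ} {ℓ : ℝ≥0} (i : Fin (n + 2)) (x : ProperChain X (n + 1) ℓ) :
    face i x = gen ℓ (remove x.1 i) := by
  unfold face gen
  by_cases h : length (remove x.1 i) = ℓ
  · rw [dif_pos h, dif_pos ⟨isProper_remove x.1 i x.2.1 (h.trans x.2.2.symm), h⟩]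
  · rw [dif_neg h, dif_neg fun h' => h h'.2]

theorem boundary_single {n : ℕ} {ℓ : ℝ≥0} (x : ProperChain X (n + 1) ℓ) :
    boundary X n ℓ (Finsupp.single x 1) =
      ∑ i : Fin (n + 2), (-1 : ℤ) ^ (i : ℕ) • gen ℓ (remove x.1 i) := by
  simp [boundary, face_eq_gen]

theorem chainMap_single (f : X → Y) {n : ℕ} {ℓ : ℝ≥0} (x : ProperChain X n ℓ) :
    chainMap f n ℓ (Finsupp.single x 1) = gen ℓ (f ∘ x.1) := by
  simp only [chainMap, Finsupp.linearCombination_single, one_smul]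
  rfl

theorem boundary_gen_remove {n : ℕ} {ℓ : ℝ≥0} (x : ProperChain X (n + 2) ℓ) (i : Fin (n + 3)) :
    boundary X n ℓ (gen ℓ (remove x.1 i)) =
      ∑ j : Fin (n + 2), (-1 : ℤ) ^ (j : ℕ) • gen ℓ (remove (remove x.1 i) j) := by
  have hle : length (remove x.1 i) ≤ ℓ := (length_remove_le x.1 i).trans x.2.2.le
  rcases hle.lt_or_eq with h | h
  · rw [gen_of_lt _ h, map_zero]
    refine (Finset.sum_eq_zero fun j _ => ?_).symm
    rw [gen_of_lt _ ((length_remove_le _ j).trans_lt h), smul_zero]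
  · have hp := isProper_remove x.1 i x.2.1 (h.trans x.2.2.symm)
    have e := gen_val (⟨remove x.1 i, hp, h⟩ : ProperChain X (n + 1) ℓ)
    rw [e, boundary_single]

theorem boundary_boundary (n : ℕ) (ℓ : ℝ≥0) :
    boundary X n ℓ ∘ₗ boundary X (n + 1) ℓ = 0 := by
  refine Finsupp.lhom_ext' fun x => LinearMap.ext_ring ?_
  simp only [LinearMap.comp_apply, Finsupp.lsingle_apply, LinearMap.zero_apply]
  rw [boundary_single, map_sum]
  simp only [map_smul, boundary_gen_remove, Finset.smul_sum, smul_smul]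
  rw [← Finset.sum_product']
  refine Finset.sum_involution (fun p _ => (p.1.succAbove p.2, p.2.predAbove p.1)) ?_ ?_ ?_ ?_
  · rintro ⟨i, j⟩ -
    simp only [remove_remove, ← pow_add, ← add_smul]
    rw [Fin.neg_one_pow_succAbove_add_predAbove]
    simp [pow_add]
  · rintro ⟨i, j⟩ - - h
    exact Fin.succAbove_ne i j (congrArg Prod.fst h)
  · intro p _
    simp
  · rintro ⟨i, j⟩ -
    simp [Fin.succAbove_succAbove_predAbove, Fin.predAbove_predAbove_succAbove]

theorem chainMap_gen_remove {f : X → Y} (hf : IsMap f) {n : ℕ} {ℓ : ℝ≥0}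
    (x : ProperChain X (n + 1) ℓ) (i : Fin (n + 2)) :
    chainMap f n ℓ (gen ℓ (remove x.1 i)) = gen ℓ (remove (f ∘ x.1) i) := by
  have hle : length (remove x.1 i) ≤ ℓ := (length_remove_le x.1 i).trans x.2.2.le
  rcases hle.lt_or_eq with h | h
  · rw [gen_of_lt _ h, map_zero,
      gen_of_lt (remove (f ∘ x.1) i) ((length_map_le hf (remove x.1 i)).trans_lt h)]
  · have hp := isProper_remove x.1 i x.2.1 (h.trans x.2.2.symm)
    have e := gen_val (⟨remove x.1 i, hp, h⟩ : ProperChain X n ℓ)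
    rw [e, chainMap_single]
    rfl

theorem boundary_chainMap {f : X → Y} (hf : IsMap f) (n : ℕ) (ℓ : ℝ≥0) :
    boundary Y n ℓ ∘ₗ chainMap f (n + 1) ℓ = chainMap f n ℓ ∘ₗ boundary X n ℓ := by
  refine Finsupp.lhom_ext' fun x => LinearMap.ext_ring ?_
  simp only [LinearMap.comp_apply, Finsupp.lsingle_apply]
  rw [boundary_single, map_sum, chainMap_single]
  simp only [map_smul, chainMap_gen_remove hf]
  have hle : length (f ∘ x.1) ≤ ℓ := (length_map_le hf x.1).trans x.2.2.le
  rcases hle.lt_or_eq with h | h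
  · rw [gen_of_lt _ h, map_zero]
    refine (Finset.sum_eq_zero fun j _ => ?_).symm
    rw [gen_of_lt _ ((length_remove_le _ j).trans_lt h), smul_zero]
  · have hp := isProper_map hf x.1 x.2.1 (h.trans x.2.2.symm)
    have e := gen_val (⟨f ∘ x.1, hp, h⟩ : ProperChain Y (n + 1) ℓ)
    rw [e, boundary_single]

variable (X) in
/-- The magnitude chain complex of `X` in length `ℓ`; the boundary map out of degree `0` is
zero. -/
def magnitudeComplex (ℓ : ℝ≥0) : ChainComplex (ModuleCat.{u} ℤ) ℕ :=
  ChainComplex.of (fun n => ModuleCat.of ℤ (MC X n ℓ)) (fun n => ModuleCat.ofHom (boundary X n ℓ))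
    fun n => by
      rw [← ModuleCat.ofHom_comp, boundary_boundary]
      rfl

theorem magnitudeComplex_d (n : ℕ) (ℓ : ℝ≥0) :
    (magnitudeComplex X ℓ).d (n + 1) n = ModuleCat.ofHom (boundary X n ℓ) :=
  ChainComplex.of_d (fun n => ModuleCat.of ℤ (MC X n ℓ))
    (fun n => ModuleCat.ofHom (boundary X n ℓ)) n

/-- The chain map `f_#` induced by a map of metric spaces, in length `ℓ`. -/
def magnitudeComplexMap (f : X → Y) (hf : IsMap f) (ℓ : ℝ≥0) :
    magnitudeComplex X ℓ ⟶ magnitudeComplex Y ℓ :=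
  ChainComplex.ofHom (fun n => ModuleCat.ofHom (chainMap f n ℓ)) fun n => by
    rw [magnitudeComplex_d, magnitudeComplex_d]
    exact congrArg ModuleCat.ofHom (boundary_chainMap hf n ℓ)

variable (X) in
/-- The magnitude homology group in degree `n` and length `ℓ`. -/
def MHl (n : ℕ) (ℓ : ℝ≥0) : ModuleCat.{u} ℤ := (magnitudeComplex X ℓ).homology n

/-- The map induced on magnitude homology in degree `n` and length `ℓ`. -/
def MHlMap (f : X → Y) (hf : IsMap f) (n : ℕ) (ℓ : ℝ≥0) : MHl X n ℓ →ₗ[ℤ] MHl Y n ℓ :=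
  (HomologicalComplex.homologyMap (magnitudeComplexMap f hf ℓ) n).hom

variable (X) in
/-- The magnitude homology in degree `n`: the direct sum over all lengths. -/
abbrev MH (n : ℕ) : Type u := DirectSum ℝ≥0 fun ℓ => MHl X n ℓ

/-- The homomorphism `f_*` on magnitude homology in degree `n`. -/
def MHMap (f : X → Y) (hf : IsMap f) (n : ℕ) : MH X n →+ MH Y n :=
  DirectSum.map fun ℓ => (MHlMap f hf n ℓ).toAddMonoidHom

end Complex

end MagnitudeHomology

/-! Call an entry of a tuple a corner if it is an end or is not between its neighbours, and call a
tuple thin if all entries are corners and consecutive ones are adjacent. A face of a proper tuple of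
positive degree is nonzero exactly when the removed entry is not a corner, and in positive degree a
thin tuple lies in the inner boundary.

From 3 to 1: a proper tuple that is not thin has a first pair of successive corners that are not
adjacent, its gap. A chosen point strictly between them lies, by alignedness, in one of the steps of
the straight run that joins them. Inserting it there, with a sign, defines a homotopy `h`.
Alignedness also keeps corners stable under removal of non-corners and under this insertion, and the
chosen point depends only on the two ends of the gap; so `x` and its nonzero faces are filled with
the same point. Hence in positive degree `∂h + h∂` is the identity on generators that are not thin
and zero on thin ones (`IsAligned.homotopy_single_eq`, `homotopy_of_isThin`). If `e` fixes the inner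
boundary, it fixes the image of `1 - ∂h - h∂`, and therefore moves cycles by boundaries
(`IsAligned.exists_boundary_eq`).

From 2 to 3: if `a` and `b` are adjacent, the tuple `(a, b, a, …)` is a cycle, and it occurs in no
boundary (`boundary_apply_of_adjacent`). Its coefficient is thus a functional on homology classes,
so its image under `e` must be the tuple itself, and `e a = a` (`eq_of_homologyMap_eq_id`). -/

namespace MagnitudeHomology

universe u

/-! ### Betweenness and corners in sequences -/

section Sequences

section

variable {X : Type u}

/-- A sequence with its `j`th entry removed. -/
def removeSeq (u : ℕ → X) (j : ℕ) : ℕ → X := fun i => if i < j then u i else u (i + 1)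

theorem removeSeq_of_lt (u : ℕ → X) {i j : ℕ} (h : i < j) : removeSeq u j i = u i := if_pos h

theorem removeSeq_of_le (u : ℕ → X) {i j : ℕ} (h : j ≤ i) : removeSeq u j i = u (i + 1) :=
  if_neg (by omega)

/-- A sequence with the point `m` inserted at the position `p`. -/
def insertSeq (u : ℕ → X) (p : ℕ) (m : X) : ℕ → X :=
  fun i => if i < p then u i else if i = p then m else u (i - 1)

theorem insertSeq_of_lt (u : ℕ → X) {p i : ℕ} (m : X) (h : i < p) : insertSeq u p m i = u i :=
  if_pos h

theorem insertSeq_self (u : ℕ → X) (p : ℕ) (m : X) : insertSeq u p m p = m := by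
  simp [insertSeq]

theorem insertSeq_succ (u : ℕ → X) {p i : ℕ} (m : X) (h : p ≤ i) :
    insertSeq u p m (i + 1) = u i := by
  unfold insertSeq
  rw [if_neg (by omega), if_neg (by omega), Nat.add_sub_cancel]

end

variable {X : Type u} [MetricSpace X]

theorem between_self_left (a b : X) : Between a a b := by simp [Between]

theorem between_self_right (a b : X) : Between a b b := by simp [Between]

theorem Between.symm {a b c : X} (h : Between a b c) : Between c b a := by
  unfold Between at *
  rw [dist_comm c a, dist_comm c b, dist_comm b a, h, add_comm]

theorem Adjacent.symm {a b : X} (h : Adjacent a b) : Adjacent b a :=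
  ⟨h.1.symm, fun ⟨z, hz, h₁, h₂⟩ => h.2 ⟨z, hz.symm, h₂.symm, h₁.symm⟩⟩

/-- The triangle inequality alone gives this and its mirror image; the converse implications need
alignedness (`IsAligned.between_extend`). -/
theorem Between.restrict_right {a b c d : X} (h : Between a b d) (h' : Between b c d) :
    Between a b c := by
  unfold Between at *
  linarith [dist_triangle a b c, dist_triangle a c d]

theorem Between.restrict_left {a b c d : X} (h : Between a c d) (h' : Between a b c) :
    Between b c d := by
  unfold Between at *
  linarith [dist_triangle b c d, dist_triangle a b d]

/-- A sequence has no two equal consecutive entries up to the index `n`. -/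
def ProperSeq (u : ℕ → X) (n : ℕ) : Prop := ∀ i < n, u i ≠ u (i + 1)

/-- In an aligned space, a straight run of a sequence subdivides the interval it spans. -/
theorem IsAligned.between_iff (hX : IsAligned X) {u : ℕ → X} {n s t : ℕ} (hu : ProperSeq u n)
    (hst : s < t) (htn : t ≤ n)
    (h : ∀ i, s < i → i < t → Between (u (i - 1)) (u i) (u (i + 1))) (w : X) :
    Between (u s) w (u t) ↔ ∃ i, s ≤ i ∧ i < t ∧ Between (u i) w (u (i + 1)) := by
  have key := hX (t - s) (fun i => u (s + i)) (by omega) (fun i hi => by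
    have h1 := h (s + (i + 1)) (by omega) (by omega)
    have h2 := hu (s + i) (by omega)
    have h3 := hu (s + (i + 1)) (by omega)
    exact ⟨h1, h2, h3⟩)
  have key' := Set.ext_iff.1 key w
  simp only [closedInterval, Set.mem_ofPred_eq, Set.mem_iUnion, Fin.val_zero, Fin.val_last,
    Fin.val_castSucc, Fin.val_succ, add_zero] at key'
  rw [show s + (t - s) = t by omega] at key'
  rw [key']
  constructor
  · rintro ⟨i, hi⟩
    exact ⟨s + i, by omega, by omega, hi⟩
  · rintro ⟨i, h1, h2, h3⟩
    refine ⟨⟨i - s, by omega⟩, ?_⟩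
    rw [show s + (i - s) = i by omega, show s + (i - s + 1) = i + 1 by omega]
    exact h3

theorem IsAligned.between_of_le (hX : IsAligned X) {u : ℕ → X} {n s t : ℕ} (hu : ProperSeq u n)
    (htn : t ≤ n) (h : ∀ i, s < i → i < t → Between (u (i - 1)) (u i) (u (i + 1)))
    {a b c : ℕ} (ha : s ≤ a) (hab : a ≤ b) (hbc : b ≤ c) (hc : c ≤ t) :
    Between (u a) (u b) (u c) := by
  rcases hbc.eq_or_lt with rfl | hbc
  · exact between_self_right _ _
  · exact (hX.between_iff hu (by omega) (by omega : c ≤ n)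
      (fun i h1 h2 => h i (by omega) (by omega)) _).2 ⟨b, hab, hbc, between_self_left _ _⟩

/-- Alignedness of `a, b, c, d`: both `b` and `c` are ends of subintervals. It makes betweenness
survive when a neighbour is replaced by a point further along. -/
theorem IsAligned.between_extend (hX : IsAligned X) {a b c d : X} (hab : a ≠ b) (hbc : b ≠ c)
    (hcd : c ≠ d) (h : Between a b c) (h' : Between b c d) :
    Between a b d ∧ Between a c d := by
  let u : ℕ → X := fun i => match i with
    | 0 => a
    | 1 => b
    | 2 => c
    | _ => d
  have hu : ProperSeq u 3 := fun i hi => by interval_cases i <;> assumption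
  have hs : ∀ i, 0 < i → i < 3 → Between (u (i - 1)) (u i) (u (i + 1)) := fun i h1 h2 => by
    interval_cases i <;> assumption
  exact ⟨hX.between_of_le hu le_rfl hs (a := 0) (b := 1) (c := 3) (by omega) (by omega) (by omega)
    (by omega), hX.between_of_le hu le_rfl hs (a := 0) (b := 2) (c := 3) (by omega) (by omega)
    (by omega) (by omega)⟩

/-- The corners of a sequence `u₀, …, uₙ` are its ends and the entries that are not between
their neighbours. -/
def Corner (u : ℕ → X) (n i : ℕ) : Prop :=
  i = 0 ∨ i = n ∨ ¬ Between (u (i - 1)) (u i) (u (i + 1))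

theorem not_corner_iff {u : ℕ → X} {n i : ℕ} :
    ¬ Corner u n i ↔ i ≠ 0 ∧ i ≠ n ∧ Between (u (i - 1)) (u i) (u (i + 1)) := by
  unfold Corner
  tauto

/-- Removing an entry that is not a corner does not change which earlier entries are corners. -/
theorem IsAligned.corner_removeSeq_of_lt (hX : IsAligned X) {u : ℕ → X} {n i j : ℕ}
    (hu : ProperSeq u (n + 1)) (hj : ¬ Corner u (n + 1) j) (hjn : j ≤ n + 1) (hi : i < j) :
    Corner (removeSeq u j) n i ↔ Corner u (n + 1) i := by
  obtain ⟨h0, h1, h2⟩ := not_corner_iff.1 hj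
  rcases Nat.eq_zero_or_pos i with rfl | hi0
  · simp [Corner]
  have e : Between (removeSeq u j (i - 1)) (removeSeq u j i) (removeSeq u j (i + 1)) ↔
      Between (u (i - 1)) (u i) (u (i + 1)) := by
    rw [removeSeq_of_lt u hi, removeSeq_of_lt u (by omega : i - 1 < j)]
    rcases (by omega : i + 1 < j ∨ i + 1 = j) with h | rfl
    · rw [removeSeq_of_lt u h]
    -- Only the entry just before `j` gets a new neighbour, `u (j + 1)` in place of `u j`.
    · rw [removeSeq_of_le u le_rfl]
      have hp := hu (i - 1) (by omega)
      rw [Nat.sub_add_cancel hi0] at hp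
      exact ⟨fun h => h.restrict_right h2,
        fun h => (hX.between_extend hp (hu i (by omega)) (hu (i + 1) (by omega)) h h2).1⟩
  have hc : (i = n ↔ i = n + 1) := by omega
  unfold Corner
  rw [e, hc]

/-- Removing an entry that is not a corner does not change which later entries are corners. -/
theorem IsAligned.corner_removeSeq_of_le (hX : IsAligned X) {u : ℕ → X} {n i j : ℕ}
    (hu : ProperSeq u (n + 1)) (hj : ¬ Corner u (n + 1) j) (hi : j ≤ i) (hin : i ≤ n) :
    Corner (removeSeq u j) n i ↔ Corner u (n + 1) (i + 1) := by
  obtain ⟨h0, h1, h2⟩ := not_corner_iff.1 hj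
  rcases hin.eq_or_lt with rfl | hin
  · simp [Corner]
  have e : Between (removeSeq u j (i - 1)) (removeSeq u j i) (removeSeq u j (i + 1)) ↔
      Between (u (i + 1 - 1)) (u (i + 1)) (u (i + 1 + 1)) := by
    rw [removeSeq_of_le u hi, removeSeq_of_le u (by omega : j ≤ i + 1), Nat.add_sub_cancel]
    rcases hi.lt_or_eq with h | rfl
    · rw [removeSeq_of_le u (by omega : j ≤ i - 1), Nat.sub_add_cancel (by omega)]
    · rw [removeSeq_of_lt u (by omega : j - 1 < j)]
      have hp := hu (j - 1) (by omega)
      rw [Nat.sub_add_cancel (by omega)] at hp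
      exact ⟨fun h => h.restrict_left h2,
        fun h => (hX.between_extend hp (hu j (by omega)) (hu (j + 1) (by omega)) h2 h).2⟩
  have hc : (i = 0 ↔ i + 1 = 0) := by omega
  have hc' : (i = n ↔ i + 1 = n + 1) := by omega
  unfold Corner
  rw [e, hc, hc']

/-! ### Gaps and slots -/

open Classical in
/-- A chosen point strictly between two points, if there is one. -/
noncomputable def midpoint (a b : X) : X :=
  if h : ∃ z, StrictlyBetween a z b then h.choose else a

theorem midpoint_spec {a b : X} (hab : a ≠ b) (h : ¬ Adjacent a b) :
    StrictlyBetween a (midpoint a b) b := by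
  have h' : ∃ z, StrictlyBetween a z b := by
    by_contra h'
    exact h ⟨hab, h'⟩
  unfold midpoint
  rw [dif_pos h']
  exact h'.choose_spec

/-- In the sequence `u₀, …, uₙ`, the first two successive corners that are not adjacent are
`uₛ` and `uₜ`; the point `m` is their chosen midpoint. -/
structure IsGap (u : ℕ → X) (n s t : ℕ) (m : X) : Prop where
  lt : s < t
  le : t ≤ n
  corner_left : ∀ i ≤ s, Corner u n i
  corner_right : Corner u n t
  not_corner : ∀ i, s < i → i < t → ¬ Corner u n i
  adjacent : ∀ i < s, Adjacent (u i) (u (i + 1))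
  eq_midpoint : m = midpoint (u s) (u t)
  strictlyBetween : StrictlyBetween (u s) m (u t)

/-- The point `m` is to be inserted at the position `p` of the sequence `u₀, …, uₙ`. -/
def IsSlot (u : ℕ → X) (n p : ℕ) (m : X) : Prop :=
  ∃ s t, IsGap u n s t m ∧ s < p ∧ p ≤ t ∧ Between (u (p - 1)) m (u p)

theorem IsGap.straight {u : ℕ → X} {n s t : ℕ} {m : X} (h : IsGap u n s t m) :
    ∀ i, s < i → i < t → Between (u (i - 1)) (u i) (u (i + 1)) :=
  fun i h1 h2 => (not_corner_iff.1 (h.not_corner i h1 h2)).2.2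

/-- If `s < s'`, then `s + 1` is a corner, so `t = s + 1`; but `h'` makes `u s` and `u (s + 1)`
adjacent, which `m` contradicts. -/
theorem IsGap.le_left {u : ℕ → X} {n s t s' t' : ℕ} {m m' : X} (h : IsGap u n s t m)
    (h' : IsGap u n s' t' m') : s' ≤ s := by
  by_contra! hs
  have ht : t = s + 1 := by
    by_contra ht
    exact h.not_corner (s + 1) (by omega) (by have := h.lt; omega) (h'.corner_left _ (by omega))
  exact (h'.adjacent s hs).2 ⟨m, ht ▸ h.strictlyBetween⟩

theorem IsGap.unique {u : ℕ → X} {n s t s' t' : ℕ} {m m' : X} (h : IsGap u n s t m)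
    (h' : IsGap u n s' t' m') : s = s' ∧ t = t' ∧ m = m' := by
  obtain rfl : s = s' := le_antisymm (h'.le_left h) (h.le_left h')
  obtain rfl : t = t' := by
    rcases lt_trichotomy t t' with ht | ht | ht
    · exact absurd h.corner_right (h'.not_corner t h.lt ht)
    · exact ht
    · exact absurd h'.corner_right (h.not_corner t' h'.lt ht)
  exact ⟨rfl, rfl, h.eq_midpoint.trans h'.eq_midpoint.symm⟩

theorem IsSlot.pos {u : ℕ → X} {n p : ℕ} {m : X} (h : IsSlot u n p m) : 0 < p := by
  obtain ⟨s, t, -, h1, -⟩ := h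
  omega

theorem IsSlot.le {u : ℕ → X} {n p : ℕ} {m : X} (h : IsSlot u n p m) : p ≤ n := by
  obtain ⟨s, t, hg, -, h1, -⟩ := h
  exact h1.trans hg.le

theorem IsSlot.between {u : ℕ → X} {n p : ℕ} {m : X} (h : IsSlot u n p m) :
    Between (u (p - 1)) m (u p) := by
  obtain ⟨s, t, -, -, -, h1⟩ := h
  exact h1

/-- Two slots of a sequence agree, unless the point to be inserted is the entry between them. -/
theorem IsAligned.isSlot_unique (hX : IsAligned X) {u : ℕ → X} {n p q : ℕ} {m m' : X}
    (hu : ProperSeq u n) (hp : IsSlot u n p m) (hq : IsSlot u n q m') (hpq : p ≤ q) :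
    m = m' ∧ (p = q ∨ (m = u p ∧ q = p + 1)) := by
  obtain ⟨s, t, hg, hsp, hpt, hm⟩ := hp
  obtain ⟨s', t', hg', hsq, hqt, hm'⟩ := hq
  obtain ⟨rfl, rfl, rfl⟩ := hg.unique hg'
  refine ⟨rfl, ?_⟩
  rcases hpq.eq_or_lt with h | h
  · exact Or.inl h
  right
  have hd := fun {a b c : ℕ} => hX.between_of_le hu hg.le hg.straight (a := a) (b := b) (c := c)
  have h1 : Between (u s) (u (p - 1)) (u p) := hd (by omega) (by omega) (by omega) (by omega)
  have h2 : Between (u s) (u p) (u (q - 1)) := hd (by omega) (by omega) (by omega) (by omega)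
  have h3 : Between (u s) (u (q - 1)) (u q) := hd (by omega) (by omega) (by omega) (by omega)
  have h4 : Between (u s) (u q) (u t) := hd (by omega) (by omega) (by omega) (by omega)
  have h5 := hg.strictlyBetween.1
  -- The slot at `p` bounds `d(uₛ, m)` by `d(uₛ, uₚ) - d(m, uₚ)`, and the slot at `q` places `m`
  -- beyond `u (q - 1)`. As `m` is between `uₛ` and `uₜ`, there is no room for a detour.
  have key : dist m (u p) + dist (u p) (u (q - 1)) = 0 := by
    unfold Between at *
    have a1 := dist_triangle (u s) (u (p - 1)) m
    have a4 := dist_triangle m (u q) (u t)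
    have a5 := dist_nonneg (x := m) (y := u p)
    have a6 := dist_nonneg (x := u p) (y := u (q - 1))
    have a7 := dist_triangle m (u p) (u (q - 1))
    have a8 := dist_triangle (u s) (u (q - 1)) m
    have a9 := dist_nonneg (x := u (q - 1)) (y := m)
    linarith
  have k1 : dist m (u p) = 0 := by
    linarith [dist_nonneg (x := m) (y := u p), dist_nonneg (x := u p) (y := u (q - 1))]
  have k2 : dist (u p) (u (q - 1)) = 0 := by
    linarith [dist_nonneg (x := m) (y := u p), dist_nonneg (x := u p) (y := u (q - 1))]
  refine ⟨dist_eq_zero.1 k1, ?_⟩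
  by_contra hne
  have h6 : Between (u p) (u (p + 1)) (u (q - 1)) :=
    hd (by omega) (by omega) (by omega) (by omega)
  have h7 := dist_pos.2 (hu p (by have := hg.le; omega))
  unfold Between at h6
  linarith [dist_nonneg (x := u (p + 1)) (y := u (q - 1))]

/-- The entries of a sequence are all corners, and successive entries are adjacent. -/
def ThinSeq (u : ℕ → X) (n : ℕ) : Prop :=
  ∀ i < n, Corner u n (i + 1) ∧ Adjacent (u i) (u (i + 1))

/-- A sequence which is not thin has a slot. -/
theorem IsAligned.exists_isSlot (hX : IsAligned X) {u : ℕ → X} {n : ℕ} (hu : ProperSeq u n)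
    (h : ¬ ThinSeq u n) : ∃ p m, IsSlot u n p m := by
  classical
  have hex : ∃ i, i < n ∧ ¬ (Corner u n (i + 1) ∧ Adjacent (u i) (u (i + 1))) := by
    unfold ThinSeq at h
    push Not at h ⊢
    exact h
  let s := Nat.find hex
  obtain ⟨hsn, hs⟩ : s < n ∧ ¬ (Corner u n (s + 1) ∧ Adjacent (u s) (u (s + 1))) :=
    Nat.find_spec hex
  have hlt : ∀ i < s, Corner u n (i + 1) ∧ Adjacent (u i) (u (i + 1)) := fun i hi => by
    by_contra hc
    exact Nat.find_min hex hi ⟨by omega, hc⟩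
  have hcl : ∀ i ≤ s, Corner u n i := fun i hi => by
    rcases Nat.eq_zero_or_pos i with rfl | h0
    · exact Or.inl rfl
    · have := (hlt (i - 1) (by omega)).1
      rwa [Nat.sub_add_cancel h0] at this
  have hex' : ∃ t, s < t ∧ Corner u n t := ⟨n, hsn, Or.inr (Or.inl rfl)⟩
  let t := Nat.find hex'
  obtain ⟨hst, htc⟩ : s < t ∧ Corner u n t := Nat.find_spec hex'
  have htn : t ≤ n := Nat.find_min' hex' ⟨hsn, Or.inr (Or.inl rfl)⟩
  have hnc : ∀ i, s < i → i < t → ¬ Corner u n i := fun i h1 h2 h3 =>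
    Nat.find_min hex' h2 ⟨h1, h3⟩
  have hstr : ∀ i, s < i → i < t → Between (u (i - 1)) (u i) (u (i + 1)) :=
    fun i h1 h2 => (not_corner_iff.1 (hnc i h1 h2)).2.2
  have h1 : Between (u s) (u (s + 1)) (u t) :=
    hX.between_of_le hu htn hstr le_rfl (by omega) (by omega) le_rfl
  have hd := dist_pos.2 (hu s hsn)
  have hne : u s ≠ u t := by
    refine dist_pos.1 ?_
    unfold Between at h1
    linarith [dist_nonneg (x := u (s + 1)) (y := u t)]
  have hna : ¬ Adjacent (u s) (u t) := by
    intro ha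
    -- If `t = s + 1`, only adjacency can have failed at `s`; otherwise `u (s + 1)` is itself
    -- strictly between.
    rcases (by omega : t = s + 1 ∨ s + 1 < t) with ht | ht
    · exact hs ⟨ht ▸ htc, ht ▸ ha⟩
    · refine ha.2 ⟨u (s + 1), h1, hu s hsn, dist_pos.1 ?_⟩
      have h2 : Between (u (s + 1)) (u (s + 2)) (u t) :=
        hX.between_of_le hu htn hstr (by omega) (by omega) (by omega) le_rfl
      unfold Between at h2
      linarith [dist_nonneg (x := u (s + 2)) (y := u t), dist_pos.2 (hu (s + 1) (by omega))]
  have hm := midpoint_spec hne hna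
  obtain ⟨i, hsi, hit, hi⟩ := (hX.between_iff hu hst htn hstr _).1 hm.1
  exact ⟨i + 1, _, s, t, ⟨hst, htn, hcl, htc, hnc, fun i hi => (hlt i hi).2, rfl, hm⟩,
    by omega, by omega, hi⟩

theorem ThinSeq.not_isSlot {u : ℕ → X} {n p : ℕ} {m : X} (h : ThinSeq u n) :
    ¬ IsSlot u n p m := by
  rintro ⟨s, t, hg, -⟩
  have hlt := hg.lt
  have hle := hg.le
  have ht : t = s + 1 := by
    by_contra ht
    exact hg.not_corner (s + 1) (by omega) (by omega) (h s (by omega)).1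
  exact (h s (by omega)).2.2 ⟨m, ht ▸ hg.strictlyBetween⟩

/-- Removing an entry that is not a corner preserves slots. -/
theorem IsAligned.isSlot_removeSeq (hX : IsAligned X) {u : ℕ → X} {n j p : ℕ} {m : X}
    (hu : ProperSeq u (n + 1)) (hj : ¬ Corner u (n + 1) j) (hjn : j ≤ n + 1)
    (h : IsSlot u (n + 1) p m) : IsSlot (removeSeq u j) n (if j < p then p - 1 else p) m := by
  obtain ⟨s, t, hg, hsp, hpt, hm⟩ := h
  obtain ⟨hj0, hj1, hj2⟩ := not_corner_iff.1 hj
  have hsj : s < j := by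
    by_contra hs
    exact hj (hg.corner_left j (by omega))
  have hjt : j ≠ t := fun h => hj (h ▸ hg.corner_right)
  have htn := hg.le
  have hst := hg.lt
  have hlt := fun {i : ℕ} (hi : i < j) => hX.corner_removeSeq_of_lt hu hj hjn hi
  have hle := fun {i : ℕ} (hi : j ≤ i) (hi' : i ≤ n) => hX.corner_removeSeq_of_le hu hj hi hi'
  have hus : removeSeq u j s = u s := removeSeq_of_lt u hsj
  have hcl : ∀ i ≤ s, Corner (removeSeq u j) n i := fun i hi =>
    (hlt (by omega)).2 (hg.corner_left i hi)
  have hadj : ∀ i < s, Adjacent (removeSeq u j i) (removeSeq u j (i + 1)) := fun i hi => by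
    rw [removeSeq_of_lt u (by omega), removeSeq_of_lt u (by omega)]
    exact hg.adjacent i hi
  -- A removal inside the gap moves its right end to `t - 1`; a removal beyond the gap leaves it
  -- alone.
  rcases hjt.lt_or_gt with hjt | hjt
  · have hut : removeSeq u j (t - 1) = u t := by
      rw [removeSeq_of_le u (by omega), Nat.sub_add_cancel (by omega)]
    refine ⟨s, t - 1, ⟨by omega, by omega, hcl, ?_, ?_, hadj, ?_, ?_⟩, ?_, ?_, ?_⟩
    · rw [hle (by omega) (by omega), Nat.sub_add_cancel (by omega)]
      exact hg.corner_right
    · intro i h1 h2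
      rcases lt_or_ge i j with h3 | h3
      · rw [hlt h3]
        exact hg.not_corner i h1 (by omega)
      · rw [hle h3 (by omega)]
        exact hg.not_corner (i + 1) (by omega) (by omega)
    · rw [hus, hut]
      exact hg.eq_midpoint
    · rw [hus, hut]
      exact hg.strictlyBetween
    · split_ifs <;> omega
    · split_ifs <;> omega
    -- If `j` borders the slot, the step that contains `m` merges with its neighbour into one from
    -- `u (j - 1)` to `u (j + 1)`, which still contains `m`.
    · have hw : ∀ k, j - 1 ≤ k → k < j + 1 → Between (u k) m (u (k + 1)) →
          Between (u (j - 1)) m (u (j + 1)) := fun k h1 h2 h3 =>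
        (hX.between_iff hu (by omega) (by omega) (fun i h4 h5 => by
          obtain rfl : i = j := by omega
          exact hj2) m).2 ⟨k, h1, h2, h3⟩
      split_ifs with hjp
      · rw [removeSeq_of_le u (by omega : j ≤ p - 1), Nat.sub_add_cancel (by omega)]
        rcases (by omega : j < p - 1 ∨ p = j + 1) with h1 | rfl
        · rw [removeSeq_of_le u (by omega), Nat.sub_add_cancel (by omega)]
          exact hm
        · rw [removeSeq_of_lt u (by omega)]
          exact hw j (by omega) (by omega) hm
      · rw [removeSeq_of_lt u (by omega : p - 1 < j)]
        rcases (by omega : p < j ∨ p = j) with h1 | rfl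
        · rw [removeSeq_of_lt u h1]
          exact hm
        · rw [removeSeq_of_le u le_rfl]
          refine hw (p - 1) le_rfl (by omega) ?_
          rw [Nat.sub_add_cancel (by omega)]
          exact hm
  · have hut : removeSeq u j t = u t := removeSeq_of_lt u hjt
    rw [if_neg (by omega)]
    refine ⟨s, t, ⟨hst, by omega, hcl, (hlt hjt).2 hg.corner_right, fun i h1 h2 => ?_, hadj,
      ?_, ?_⟩, hsp, hpt, ?_⟩
    · rw [hlt (by omega)]
      exact hg.not_corner i h1 h2
    · rw [hus, hut]
      exact hg.eq_midpoint
    · rw [hus, hut]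
      exact hg.strictlyBetween
    · rw [removeSeq_of_lt u (by omega), removeSeq_of_lt u (by omega)]
      exact hm

/-- Filling a slot does not turn corners into non-corners; the entry `uⱼ` has the index `j`
or `j + 1` after the insertion. -/
theorem IsAligned.corner_insertSeq (hX : IsAligned X) {u : ℕ → X} {n j p : ℕ} {m : X}
    (hu : ProperSeq u n) (h : IsSlot u n p m) (hj : j ≤ n) (hc : Corner u n j) :
    Corner (insertSeq u p m) (n + 1) (if j < p then j else j + 1) := by
  obtain ⟨s, t, hg, hsp, hpt, hm⟩ := h
  have htn := hg.le
  rcases Nat.eq_zero_or_pos j with rfl | hj0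
  · rw [if_pos (by omega)]
    exact Or.inl rfl
  rcases hj.eq_or_lt with rfl | hj
  · rw [if_neg (by omega)]
    exact Or.inr (Or.inl rfl)
  have hb : ¬ Between (u (j - 1)) (u j) (u (j + 1)) := by
    rcases hc with h1 | h1 | h1
    · omega
    · omega
    · exact h1
  refine Or.inr (Or.inr fun hb' => hb ?_)
  have hp1 := hu (j - 1) (by omega)
  rw [Nat.sub_add_cancel hj0] at hp1
  have hp2 := hu j (by omega)
  split_ifs at hb' with hjp
  · rw [insertSeq_of_lt u m hjp, insertSeq_of_lt u m (by omega : j - 1 < p)] at hb'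
    rcases (by omega : j + 1 < p ∨ p = j + 1) with h1 | rfl
    · rwa [insertSeq_of_lt u m h1] at hb'
    · rw [insertSeq_self] at hb'
      rw [Nat.add_sub_cancel] at hm
      -- As `m` differs from the ends of the gap, an entry equal to it here would be strictly inside
      -- the gap and so not a corner.
      by_cases e1 : u j = m
      · refine absurd hc (hg.not_corner j (lt_of_le_of_ne (by omega) ?_) (by omega))
        rintro rfl
        exact hg.strictlyBetween.2.1 e1
      by_cases e2 : m = u (j + 1)
      · rwa [← e2]
      exact (hX.between_extend hp1 e1 e2 hb' hm).1
  · rw [insertSeq_succ u m (by omega), insertSeq_succ u m (by omega), Nat.add_sub_cancel] at hb'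
    rcases (by omega : p < j ∨ j = p) with h1 | rfl
    · obtain ⟨k, rfl⟩ : ∃ k, j = k + 1 := ⟨j - 1, by omega⟩
      rwa [insertSeq_succ u m (by omega)] at hb'
    · rw [insertSeq_self] at hb'
      by_cases e1 : m = u j
      · refine absurd hc (hg.not_corner j hsp (lt_of_le_of_ne hpt ?_))
        rintro rfl
        exact hg.strictlyBetween.2.2 e1
      by_cases e2 : u (j - 1) = m
      · rwa [e2]
      exact (hX.between_extend e2 e1 hp2 hm hb').2

end Sequences

/-! ### Tuples as sequences: lengths, faces and insertions -/

section Tuples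

variable {X : Type u}

/-- A tuple as a sequence, constant from the last entry on. -/
def toSeq {n : ℕ} (x : Fin (n + 1) → X) (i : ℕ) : X := x ⟨min i n, by omega⟩

theorem toSeq_of_le {n : ℕ} (x : Fin (n + 1) → X) {i : ℕ} (h : i ≤ n) :
    toSeq x i = x ⟨i, by omega⟩ := by
  unfold toSeq
  congr 2
  omega

theorem toSeq_val {n : ℕ} (x : Fin (n + 1) → X) (i : Fin (n + 1)) : toSeq x i = x i :=
  toSeq_of_le x (by omega)

/-- Removing the last entry is excluded: the constant tail would then be `x n` on the left but `x (n
+ 1)` on the right. -/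
theorem toSeq_remove {n : ℕ} (x : Fin (n + 2) → X) (j : Fin (n + 2)) (hj : (j : ℕ) ≤ n) :
    toSeq (remove x j) = removeSeq (toSeq x) j := by
  funext i
  unfold toSeq remove removeSeq
  split_ifs with h
  · rw [Fin.succAbove_of_castSucc_lt _ _ (by rw [Fin.lt_def]; simp; omega)]
    congr 1
    ext
    simp
    omega
  · rw [Fin.succAbove_of_le_castSucc _ _ (by rw [Fin.le_def]; simp; omega)]
    congr 1
    ext
    simp

theorem remove_insertNth_self {n : ℕ} (x : Fin (n + 1) → X) (p : Fin (n + 2)) (m : X) :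
    remove (p.insertNth m x : Fin (n + 2) → X) p = x :=
  funext fun j => Fin.insertNth_apply_succAbove (α := fun _ => X) p m x j

theorem toSeq_insertNth {n : ℕ} (x : Fin (n + 1) → X) (p : Fin (n + 2)) (m : X)
    (hp : (p : ℕ) ≤ n) :
    toSeq (p.insertNth m x : Fin (n + 2) → X) = insertSeq (toSeq x) p m := by
  have h := toSeq_remove (p.insertNth m x : Fin (n + 2) → X) p hp
  rw [remove_insertNth_self] at h
  rw [h]
  funext i
  rcases lt_trichotomy i p with hi | rfl | hi
  · rw [insertSeq_of_lt _ _ hi, removeSeq_of_lt _ hi]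
  · rw [insertSeq_self, toSeq_val, Fin.insertNth_apply_same]
  · obtain ⟨k, rfl⟩ : ∃ k, i = k + 1 := ⟨i - 1, by omega⟩
    rw [insertSeq_succ _ _ (by omega), removeSeq_of_le _ (by omega)]

theorem isProper_iff_properSeq {n : ℕ} (x : Fin (n + 1) → X) :
    IsProper x ↔ ProperSeq (toSeq x) n := by
  constructor
  · intro h i hi
    rw [toSeq_of_le x (by omega), toSeq_of_le x (by omega)]
    exact h ⟨i, hi⟩
  · intro h i
    have := h i i.2
    rwa [toSeq_of_le x (by omega), toSeq_of_le x (by omega)] at this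

variable [MetricSpace X]

theorem remove_insertNth_succAbove {n : ℕ} (x : Fin (n + 2) → X) (p : Fin (n + 3)) (m : X)
    (j : Fin (n + 2)) :
    remove (p.insertNth m x : Fin (n + 3) → X) (p.succAbove j) =
      ((j.predAbove p).insertNth m (remove x j) : Fin (n + 2) → X) := by
  refine Fin.eq_insertNth_iff.2 ⟨?_, ?_⟩
  · unfold remove
    rw [Fin.succAbove_succAbove_predAbove, Fin.insertNth_apply_same]
  · have h := remove_remove (p.insertNth m x : Fin (n + 3) → X) p j
    rw [remove_insertNth_self] at h
    exact h

theorem length_eq_sum_range {n : ℕ} (x : Fin (n + 1) → X) :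
    length x = ∑ i ∈ Finset.range n, dist (toSeq x i) (toSeq x (i + 1)) := by
  rw [← Fin.sum_univ_eq_sum_range (fun i => dist (toSeq x i) (toSeq x (i + 1))) n]
  refine Finset.sum_congr rfl fun i _ => ?_
  rw [toSeq_of_le x (by omega), toSeq_of_le x (by omega)]
  rfl

theorem sum_dist_removeSeq (u : ℕ → X) {n j : ℕ} (hj : 0 < j) (hjn : j ≤ n) :
    ∑ i ∈ Finset.range n, dist (removeSeq u j i) (removeSeq u j (i + 1)) +
        (dist (u (j - 1)) (u j) + dist (u j) (u (j + 1))) =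
      ∑ i ∈ Finset.range (n + 1), dist (u i) (u (i + 1)) + dist (u (j - 1)) (u (j + 1)) := by
  induction n, hjn using Nat.le_induction with
  | base =>
    obtain ⟨k, rfl⟩ : ∃ k, j = k + 1 := ⟨j - 1, by omega⟩
    rw [Finset.sum_range_succ, Finset.sum_range_succ, Finset.sum_range_succ,
      removeSeq_of_lt u (by omega), removeSeq_of_le u le_rfl, Nat.add_sub_cancel]
    have h : ∑ i ∈ Finset.range k, dist (removeSeq u (k + 1) i) (removeSeq u (k + 1) (i + 1)) =
        ∑ i ∈ Finset.range k, dist (u i) (u (i + 1)) := by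
      refine Finset.sum_congr rfl fun i hi => ?_
      rw [Finset.mem_range] at hi
      rw [removeSeq_of_lt u (by omega), removeSeq_of_lt u (by omega)]
    rw [h]
    ring
  | succ n hn ih =>
    rw [Finset.sum_range_succ, Finset.sum_range_succ _ (n + 1), removeSeq_of_le u hn,
      removeSeq_of_le u (by omega : j ≤ n + 1)]
    linarith

/-- Removing an inner entry preserves the length if and only if it is between its neighbours. -/
theorem length_remove_eq_iff {n : ℕ} (y : Fin (n + 2) → X) (k : Fin (n + 2))
    (h0 : toSeq y 0 ≠ toSeq y 1) (h1 : toSeq y n ≠ toSeq y (n + 1)) :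
    length (remove y k) = length y ↔ ¬ Corner (toSeq y) (n + 1) k := by
  rw [not_corner_iff]
  -- Ends are corners by definition, and removing one loses a step of positive length by `h0` or
  -- `h1`.
  rcases Nat.eq_zero_or_pos (k : ℕ) with hk | hk
  · refine iff_of_false (fun h => ?_) (fun h => h.1 hk)
    rw [length_eq_sum_range, length_eq_sum_range, toSeq_remove y k (by omega), hk,
      Finset.sum_range_succ'] at h
    have h2 := dist_pos.2 h0
    simp only [removeSeq_of_le (toSeq y) (Nat.zero_le _), zero_add] at h
    linarith
  rcases (by omega : (k : ℕ) = n + 1 ∨ (k : ℕ) ≤ n) with hk' | hk'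
  · refine iff_of_false (fun h => ?_) (fun h => h.2.1 hk')
    have h2 : length (remove y k) = ∑ i ∈ Finset.range n, dist (toSeq y i) (toSeq y (i + 1)) := by
      rw [length_eq_sum_range]
      obtain rfl : k = Fin.last (n + 1) := Fin.ext hk'
      refine Finset.sum_congr rfl fun i hi => ?_
      rw [Finset.mem_range] at hi
      rw [toSeq_of_le _ (by omega : i ≤ n), toSeq_of_le _ (by omega : i + 1 ≤ n),
        toSeq_of_le y (by omega), toSeq_of_le y (by omega)]
      simp only [remove, Fin.succAbove_last]
      rfl
    rw [h2, length_eq_sum_range, Finset.sum_range_succ] at h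
    linarith [dist_pos.2 h1]
  · have h2 := sum_dist_removeSeq (toSeq y) hk hk'
    rw [← toSeq_remove y k hk', ← length_eq_sum_range, ← length_eq_sum_range] at h2
    unfold Between
    constructor
    · intro h
      exact ⟨by omega, by omega, by linarith⟩
    · rintro ⟨-, -, h⟩
      linarith

theorem IsProper.length_remove_eq_iff {n : ℕ} {x : Fin (n + 2) → X} (hx : IsProper x)
    (k : Fin (n + 2)) : length (remove x k) = length x ↔ ¬ Corner (toSeq x) (n + 1) k := by
  have h := (isProper_iff_properSeq x).1 hx
  exact MagnitudeHomology.length_remove_eq_iff x k (h 0 (by omega)) (h n (by omega))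

theorem length_insertNth {n : ℕ} {x : Fin (n + 1) → X} {p : Fin (n + 2)} {m : X}
    (h : IsSlot (toSeq x) n p m) :
    length (p.insertNth m x : Fin (n + 2) → X) = length x := by
  have hp := h.pos
  have hpn := h.le
  have h1 := sum_dist_removeSeq (toSeq (p.insertNth m x : Fin (n + 2) → X)) hp hpn
  rw [← toSeq_remove _ p hpn, ← length_eq_sum_range, ← length_eq_sum_range,
    remove_insertNth_self, toSeq_insertNth x p m hpn, insertSeq_of_lt _ _ (by omega),
    insertSeq_self, insertSeq_succ _ _ le_rfl] at h1
  have h2 := h.between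
  unfold Between at h2
  linarith

theorem val_predAbove {n : ℕ} (p : Fin (n + 3)) (j : Fin (n + 2)) :
    (j.predAbove p : ℕ) = if (j : ℕ) < p then (p : ℕ) - 1 else p := by
  split_ifs with h
  · rw [Fin.predAbove_of_castSucc_lt _ _ (by rwa [Fin.lt_def])]
    simp
  · rw [Fin.predAbove_of_le_castSucc _ _ (by rw [Fin.le_def]; simpa using h)]
    simp

theorem IsAligned.isSlot_remove (hX : IsAligned X) {n : ℕ} {x : Fin (n + 2) → X}
    (hx : IsProper x) {p : Fin (n + 3)} {m : X} (h : IsSlot (toSeq x) (n + 1) p m)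
    {j : Fin (n + 2)} (hj : length (remove x j) = length x) :
    IsSlot (toSeq (remove x j)) n (j.predAbove p) m := by
  have hc := (hx.length_remove_eq_iff j).1 hj
  have hjn : (j : ℕ) ≤ n := by
    have := (not_corner_iff.1 hc).2.1
    omega
  rw [val_predAbove, toSeq_remove x j hjn]
  exact hX.isSlot_removeSeq ((isProper_iff_properSeq x).1 hx) hc (by omega) h

/-- If an entry can be removed without changing the length after a slot is filled, then it can
also be removed before. -/
theorem IsAligned.length_remove_of_insertNth (hX : IsAligned X) {n : ℕ} {x : Fin (n + 2) → X}
    (hx : IsProper x) {p : Fin (n + 3)} {m : X} (h : IsSlot (toSeq x) (n + 1) p m)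
    {j : Fin (n + 2)}
    (hj : length (remove (p.insertNth m x : Fin (n + 3) → X) (p.succAbove j)) = length x) :
    length (remove x j) = length x := by
  have hu := (isProper_iff_properSeq x).1 hx
  have hp := h.pos
  have hpn := h.le
  rw [hx.length_remove_eq_iff]
  intro hc
  have hc' := hX.corner_insertSeq hu h (by omega) hc
  rw [← length_insertNth h] at hj
  obtain ⟨s, t, hg, hsp, hpt, -⟩ := h
  have htn := hg.le
  have hins := toSeq_insertNth x p m hpn
  -- The filled tuple may be improper, but its first and last steps are not degenerate, since `m`
  -- differs from both ends of the gap.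
  rw [length_remove_eq_iff] at hj
  · refine hj ?_
    rw [hins]
    convert hc' using 1
    split_ifs with hjp
    · rw [Fin.succAbove_of_castSucc_lt _ _ (by rwa [Fin.lt_def])]
      simp
    · rw [Fin.succAbove_of_le_castSucc _ _ (by rw [Fin.le_def]; simpa using hjp)]
      simp
  · rw [hins, insertSeq_of_lt _ _ hp]
    rcases (by omega : 1 < (p : ℕ) ∨ (p : ℕ) = 1) with h1 | h1
    · rw [insertSeq_of_lt _ _ h1]
      exact hu 0 (by omega)
    · obtain rfl : s = 0 := by omega
      rw [h1, insertSeq_self]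
      exact hg.strictlyBetween.2.1
  · rw [hins, insertSeq_succ _ _ hpn]
    rcases (by omega : (p : ℕ) < n + 1 ∨ (p : ℕ) = n + 1) with h1 | h1
    · rw [insertSeq_succ _ _ (by omega)]
      exact hu n (by omega)
    · obtain rfl : t = n + 1 := by omega
      rw [h1, insertSeq_self]
      exact hg.strictlyBetween.2.2

end Tuples

/-! ### The contracting homotopy onto thin chains -/

noncomputable section Homotopy

section

variable {X : Type u}

theorem not_isProper_remove {n : ℕ} {y : Fin (n + 2) → X} {i : Fin (n + 1)}
    (h : y i.castSucc = y i.succ) {k : Fin (n + 2)} (h1 : k ≠ i.castSucc) (h2 : k ≠ i.succ) :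
    ¬ IsProper (remove y k) := by
  obtain ⟨n, rfl⟩ : ∃ n', n = n' + 1 := by
    refine ⟨n - 1, ?_⟩
    have h3 := k.2
    have h4 := i.2
    simp only [ne_eq, Fin.ext_iff, Fin.val_castSucc, Fin.val_succ] at h1 h2
    omega
  simp only [ne_eq, Fin.ext_iff, Fin.val_castSucc, Fin.val_succ] at h1 h2
  intro hp
  rcases lt_or_gt_of_ne h1 with hk | hk
  · have hi : 0 < (i : ℕ) := by omega
    refine hp ⟨i - 1, by omega⟩ ?_
    unfold remove
    rw [Fin.succAbove_of_le_castSucc _ _ (by rw [Fin.le_def]; simp; omega),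
      Fin.succAbove_of_le_castSucc _ _ (by rw [Fin.le_def]; simp; omega)]
    convert h using 2 <;> ext <;> simp <;> omega
  · refine hp ⟨i, by omega⟩ ?_
    unfold remove
    rw [Fin.succAbove_of_castSucc_lt _ _ (by rw [Fin.lt_def]; simp; omega),
      Fin.succAbove_of_castSucc_lt _ _ (by rw [Fin.lt_def]; simp; omega)]
    convert h using 2 <;> ext <;> simp

theorem remove_castSucc_eq_remove_succ {n : ℕ} {y : Fin (n + 2) → X} {i : Fin (n + 1)}
    (h : y i.castSucc = y i.succ) : remove y i.castSucc = remove y i.succ := by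
  funext j
  unfold remove
  rcases lt_trichotomy j i with hj | rfl | hj
  · rw [Fin.succAbove_of_castSucc_lt _ _ (by simpa using hj),
      Fin.succAbove_of_castSucc_lt _ _ (by rw [Fin.lt_def] at *; simp; omega)]
  · rw [Fin.succAbove_castSucc_self, Fin.succAbove_succ_self, h]
  · rw [Fin.succAbove_of_le_castSucc _ _ (by rw [Fin.lt_def] at hj; rw [Fin.le_def]; simp; omega),
      Fin.succAbove_of_le_castSucc _ _ (by rw [Fin.lt_def] at hj; rw [Fin.le_def]; simp; omega)]

theorem not_isProper_of_toSeq_eq {n : ℕ} {y : Fin (n + 1) → X} {i : ℕ} (hi : i < n)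
    (h : toSeq y i = toSeq y (i + 1)) : ¬ IsProper y :=
  fun hp => (isProper_iff_properSeq y).1 hp i hi h

end

variable {X : Type u} [MetricSpace X]

theorem gen_of_not_isProper {n : ℕ} {ℓ : ℝ≥0} {x : Fin (n + 1) → X} (h : ¬ IsProper x) :
    gen ℓ x = 0 := by
  unfold gen
  rw [dif_neg fun h' => h h'.1]

theorem gen_of_length_ne {n : ℕ} {ℓ : ℝ≥0} {x : Fin (n + 1) → X} (h : length x ≠ ℓ) :
    gen ℓ x = 0 := by
  unfold gen
  rw [dif_neg fun h' => h h'.2]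

theorem gen_eq_single {n : ℕ} {ℓ : ℝ≥0} {x : Fin (n + 1) → X} (hx : IsProper x)
    (h : length x = ℓ) : gen ℓ x = Finsupp.single (⟨x, hx, h⟩ : ProperChain X n ℓ) 1 :=
  gen_val (⟨x, hx, h⟩ : ProperChain X n ℓ)

/-- The formula for the boundary holds for all tuples of length `ℓ`, proper or not. -/
theorem boundary_gen {n : ℕ} {ℓ : ℝ≥0} (y : Fin (n + 2) → X) (hy : length y = ℓ) :
    boundary X n ℓ (gen ℓ y) = ∑ k : Fin (n + 2), (-1 : ℤ) ^ (k : ℕ) • gen ℓ (remove y k) := by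
  by_cases hp : IsProper y
  · rw [gen_eq_single hp hy, boundary_single]
  · rw [gen_of_not_isProper hp, map_zero]
    unfold IsProper at hp
    push Not at hp
    obtain ⟨i, hi⟩ := hp
    symm
    -- The two faces at the repeated entry coincide and have opposite signs; every other face keeps
    -- the repetition and vanishes.
    rw [Finset.sum_eq_add i.castSucc i.succ (Fin.castSucc_lt_succ).ne]
    · rw [remove_castSucc_eq_remove_succ hi, Fin.val_castSucc, Fin.val_succ, pow_succ]
      simp
    · rintro k - ⟨h1, h2⟩
      rw [gen_of_not_isProper (not_isProper_remove hi h1 h2), smul_zero]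
    · exact fun h => absurd (Finset.mem_univ _) h
    · exact fun h => absurd (Finset.mem_univ _) h

open Classical in
/-- The contracting homotopy on generators: fill a slot, if there is one. -/
def fill {n : ℕ} {ℓ : ℝ≥0} (x : ProperChain X n ℓ) : MC X (n + 1) ℓ :=
  if h : ∃ q : Fin (n + 2) × X, IsSlot (toSeq x.1) n q.1 q.2 then
    (-1 : ℤ) ^ (h.choose.1 : ℕ) • gen ℓ (h.choose.1.insertNth h.choose.2 x.1 : Fin (n + 2) → X)
  else 0

variable (X) in
/-- The contracting homotopy. -/
def homotopy (n : ℕ) (ℓ : ℝ≥0) : MC X n ℓ →ₗ[ℤ] MC X (n + 1) ℓ :=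
  Finsupp.linearCombination ℤ fill

theorem homotopy_single {n : ℕ} {ℓ : ℝ≥0} (x : ProperChain X n ℓ) :
    homotopy X n ℓ (Finsupp.single x 1) = fill x := by
  simp [homotopy]

/-- Any two slots of a tuple give the same generator up to sign, both being zero if the slots
differ. -/
theorem IsAligned.smul_gen_insertNth (hX : IsAligned X) {n : ℕ} {ℓ : ℝ≥0} {x : Fin (n + 1) → X}
    (hx : IsProper x) {p q : Fin (n + 2)} {m m' : X} (hp : IsSlot (toSeq x) n p m)
    (hq : IsSlot (toSeq x) n q m') :
    (-1 : ℤ) ^ (p : ℕ) • gen ℓ (p.insertNth m x : Fin (n + 2) → X) =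
      (-1 : ℤ) ^ (q : ℕ) • gen ℓ (q.insertNth m' x : Fin (n + 2) → X) := by
  wlog hpq : p ≤ q generalizing p q m m'
  · exact (this hq hp (le_of_not_ge hpq)).symm
  obtain ⟨rfl, h⟩ := hX.isSlot_unique ((isProper_iff_properSeq x).1 hx) hp hq hpq
  have hpn := hp.le
  have hqn := hq.le
  rcases h with h | ⟨h1, h2⟩
  · rw [Fin.ext h]
  · rw [gen_of_not_isProper, gen_of_not_isProper, smul_zero, smul_zero]
    · refine not_isProper_of_toSeq_eq (i := p) (by omega) ?_
      rw [toSeq_insertNth x q m hqn, h2, insertSeq_self, insertSeq_of_lt _ _ (by omega), h1]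
    · refine not_isProper_of_toSeq_eq (i := p) (by omega) ?_
      rw [toSeq_insertNth x p m hpn, insertSeq_succ _ _ le_rfl, insertSeq_self, h1]

/-- The slot chosen in `fill` is immaterial, so the slot that a face inherits from `x` may be used.
-/
theorem IsAligned.fill_eq (hX : IsAligned X) {n : ℕ} {ℓ : ℝ≥0} (x : ProperChain X n ℓ)
    {p : Fin (n + 2)} {m : X} (hp : IsSlot (toSeq x.1) n p m) :
    fill x = (-1 : ℤ) ^ (p : ℕ) • gen ℓ (p.insertNth m x.1 : Fin (n + 2) → X) := by
  have h : ∃ q : Fin (n + 2) × X, IsSlot (toSeq x.1) n q.1 q.2 := ⟨(p, m), hp⟩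
  unfold fill
  rw [dif_pos h]
  exact hX.smul_gen_insertNth x.2.1 h.choose_spec hp

/-- A face that keeps its length inherits the slot, and filling commutes with removal. Otherwise `j`
is a corner of `x`, remains one after filling, and both sides vanish. -/
theorem IsAligned.homotopy_gen_remove (hX : IsAligned X) {n : ℕ} {ℓ : ℝ≥0}
    (x : ProperChain X (n + 1) ℓ) {p : Fin (n + 3)} {m : X}
    (hp : IsSlot (toSeq x.1) (n + 1) p m) (j : Fin (n + 2)) :
    homotopy X n ℓ (gen ℓ (remove x.1 j)) = (-1 : ℤ) ^ (j.predAbove p : ℕ) •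
      gen ℓ (remove (p.insertNth m x.1 : Fin (n + 3) → X) (p.succAbove j)) := by
  by_cases hj : length (remove x.1 j) = length x.1
  · have hslot := hX.isSlot_remove x.2.1 hp hj
    have hprop := isProper_remove x.1 j x.2.1 hj
    rw [gen_eq_single hprop (hj.trans x.2.2), homotopy_single, hX.fill_eq _ hslot,
      remove_insertNth_succAbove]
  · rw [gen_of_length_ne (fun h => hj (h.trans x.2.2.symm)), map_zero,
      gen_of_length_ne (fun h => hj (hX.length_remove_of_insertNth x.2.1 hp
        (h.trans x.2.2.symm))), smul_zero]

/-- Removing the inserted point returns `x` with sign `(-1)^(2p)`; the other faces of the filled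
tuple cancel against the filled faces of `x`. -/
theorem IsAligned.homotopy_of_isSlot (hX : IsAligned X) {n : ℕ} {ℓ : ℝ≥0}
    (x : ProperChain X (n + 1) ℓ) {p : Fin (n + 3)} {m : X}
    (hp : IsSlot (toSeq x.1) (n + 1) p m) :
    boundary X (n + 1) ℓ (homotopy X (n + 1) ℓ (Finsupp.single x 1)) +
      homotopy X n ℓ (boundary X n ℓ (Finsupp.single x 1)) = Finsupp.single x 1 := by
  rw [homotopy_single, hX.fill_eq x hp, map_smul, boundary_gen _ ((length_insertNth hp).trans x.2.2),
    Fin.sum_univ_succAbove _ p, remove_insertNth_self, gen_val, boundary_single, map_sum,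
    smul_add, smul_smul, ← mul_pow]
  simp only [map_smul, hX.homotopy_gen_remove x hp, Finset.smul_sum, smul_smul, ← pow_add]
  rw [add_assoc, ← Finset.sum_add_distrib, Finset.sum_eq_zero, add_zero]
  · simp
  · intro j _
    rw [← add_smul]
    have h := Fin.neg_one_pow_succAbove_add_predAbove (R := ℤ) p j
    -- By `h`, the sum of all four indices is odd; the pairing of the indices is irrelevant for the
    -- signs.
    have h2 : (-1 : ℤ) ^ ((p : ℕ) + (p.succAbove j : ℕ)) +
        (-1) ^ ((j : ℕ) + (j.predAbove p : ℕ)) = 0 := by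
      rw [pow_add] at h ⊢
      rw [pow_add] at h ⊢
      rcases neg_one_pow_eq_or ℤ (p : ℕ) with h3 | h3 <;>
      rcases neg_one_pow_eq_or ℤ (p.succAbove j : ℕ) with h4 | h4 <;>
      rcases neg_one_pow_eq_or ℤ (j : ℕ) with h5 | h5 <;>
      rcases neg_one_pow_eq_or ℤ (j.predAbove p : ℕ) with h6 | h6 <;>
      rw [h3, h4, h5, h6] at h <;> rw [h3, h4, h5, h6] <;> revert h <;> decide
    rw [h2, zero_smul]

/-- A chain is thin if all its entries are corners and successive entries are adjacent. -/
def IsThin {n : ℕ} (x : Fin (n + 1) → X) : Prop := ThinSeq (toSeq x) n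

/-- There is no slot to fill, and all entries are corners, so every face vanishes. -/
theorem homotopy_of_isThin {n : ℕ} {ℓ : ℝ≥0} (x : ProperChain X (n + 1) ℓ)
    (hx : IsThin x.1) :
    boundary X (n + 1) ℓ (homotopy X (n + 1) ℓ (Finsupp.single x 1)) +
      homotopy X n ℓ (boundary X n ℓ (Finsupp.single x 1)) = 0 := by
  have h1 : fill x = 0 := by
    unfold fill
    rw [dif_neg]
    rintro ⟨q, hq⟩
    exact hx.not_isSlot hq
  rw [homotopy_single, h1, map_zero, boundary_single, Finset.sum_eq_zero, map_zero, add_zero]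
  intro k _
  rw [gen_of_length_ne, smul_zero]
  intro h
  refine (x.2.1.length_remove_eq_iff k).1 (h.trans x.2.2.symm) ?_
  rcases Nat.eq_zero_or_pos (k : ℕ) with h0 | h0
  · exact Or.inl h0
  · have := (hx (k - 1) (by omega)).1
    rwa [Nat.sub_add_cancel h0] at this

theorem IsAligned.homotopy_single_eq (hX : IsAligned X) {n : ℕ} {ℓ : ℝ≥0}
    (x : ProperChain X (n + 1) ℓ) (hx : ¬ IsThin x.1) :
    boundary X (n + 1) ℓ (homotopy X (n + 1) ℓ (Finsupp.single x 1)) +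
      homotopy X n ℓ (boundary X n ℓ (Finsupp.single x 1)) = Finsupp.single x 1 := by
  obtain ⟨p, m, h⟩ := hX.exists_isSlot ((isProper_iff_properSeq x.1).1 x.2.1) hx
  have hp := h.le
  exact hX.homotopy_of_isSlot x (p := ⟨p, by omega⟩) h

theorem IsThin.mem_innerBoundary {n : ℕ} {x : Fin (n + 2) → X} (hx : IsThin x)
    (i : Fin (n + 2)) : x i ∈ innerBoundary X := by
  rw [← toSeq_val x i]
  rcases (by omega : (i : ℕ) < n + 1 ∨ (i : ℕ) = n + 1) with h | h
  · exact ⟨_, (hx i h).2⟩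
  · rw [h]
    exact ⟨_, (hx n (by omega)).2.symm⟩

/-- If `e` fixes the inner boundary, then on chains of positive degree it fixes the projection
to the thin chains. -/
theorem IsAligned.chainMap_sub_homotopy (hX : IsAligned X) {e : X → X}
    (h : ∀ x ∈ innerBoundary X, e x = x) {n : ℕ} {ℓ : ℝ≥0} (z : MC X (n + 1) ℓ) :
    chainMap e (n + 1) ℓ (z - (boundary X (n + 1) ℓ (homotopy X (n + 1) ℓ z) +
      homotopy X n ℓ (boundary X n ℓ z))) = z - (boundary X (n + 1) ℓ (homotopy X (n + 1) ℓ z) +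
      homotopy X n ℓ (boundary X n ℓ z)) := by
  -- `P` kills the generators that are not thin and fixes the thin ones, whose entries `e` fixes.
  let P : MC X (n + 1) ℓ →ₗ[ℤ] MC X (n + 1) ℓ := LinearMap.id -
    (boundary X (n + 1) ℓ ∘ₗ homotopy X (n + 1) ℓ + homotopy X n ℓ ∘ₗ boundary X n ℓ)
  suffices hP : chainMap e (n + 1) ℓ ∘ₗ P = P from LinearMap.congr_fun hP z
  refine Finsupp.lhom_ext' fun x => LinearMap.ext_ring ?_
  simp only [LinearMap.comp_apply, Finsupp.lsingle_apply]
  by_cases hx : IsThin x.1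
  · have hPx : P (Finsupp.single x 1) = Finsupp.single x 1 := by
      simp only [P, LinearMap.sub_apply, LinearMap.add_apply, LinearMap.comp_apply,
        homotopy_of_isThin x hx, LinearMap.id_apply, sub_zero]
    have hex : e ∘ x.1 = x.1 := funext fun i => h _ (hx.mem_innerBoundary i)
    rw [hPx, chainMap_single, hex, gen_val]
  · have hPx : P (Finsupp.single x 1) = 0 := by
      simp only [P, LinearMap.sub_apply, LinearMap.add_apply, LinearMap.comp_apply,
        hX.homotopy_single_eq x hx, LinearMap.id_apply, sub_self]
    rw [hPx, map_zero]

/-- If `e` fixes the inner boundary, then it moves each cycle of positive degree by a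
boundary. -/
theorem IsAligned.exists_boundary_eq (hX : IsAligned X) {e : X → X} (he : IsMap e)
    (h : ∀ x ∈ innerBoundary X, e x = x) {n : ℕ} {ℓ : ℝ≥0} (z : MC X (n + 1) ℓ)
    (hz : boundary X n ℓ z = 0) :
    ∃ w, boundary X (n + 1) ℓ w = chainMap e (n + 1) ℓ z - z := by
  have h1 := hX.chainMap_sub_homotopy h z
  rw [hz, map_zero, add_zero, map_sub] at h1
  have h2 := LinearMap.congr_fun (boundary_chainMap he (n + 1) ℓ) (homotopy X (n + 1) ℓ z)
  simp only [LinearMap.comp_apply] at h2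
  -- For a cycle, `z - ∂hz` is fixed by `e_#`, so `e_# z - z = e_# ∂hz - ∂hz = ∂(e_# hz - hz)`.
  refine ⟨chainMap e (n + 2) ℓ (homotopy X (n + 1) ℓ z) - homotopy X (n + 1) ℓ z, ?_⟩
  rw [map_sub, h2, sub_eq_sub_iff_sub_eq_sub, ← neg_sub, h1, neg_sub]

end Homotopy

/-! ### Alternating cycles and the induced map on homology -/

noncomputable section Homology

open CategoryTheory

section

variable {X : Type u}

/-- The tuple `(a, b, a, b, …)`. -/
def alternating (a b : X) (n : ℕ) : Fin (n + 1) → X := fun i => if Even (i : ℕ) then a else b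

theorem toSeq_alternating (a b : X) {n i : ℕ} (hi : i ≤ n) :
    toSeq (alternating a b n) i = if Even i then a else b := by
  rw [toSeq_of_le _ hi]
  rfl

end

variable {X : Type u} [MetricSpace X]

theorem Adjacent.alternating {a b : X} (h : Adjacent a b) {n : ℕ} (i : Fin n) :
    Adjacent (alternating a b n i.castSucc) (alternating a b n i.succ) := by
  simp only [MagnitudeHomology.alternating, Fin.val_castSucc, Fin.val_succ, Nat.even_add_one]
  by_cases hi : Even (i : ℕ)
  · simpa [hi] using h
  · simpa [hi] using h.symm

theorem toSeq_adjacent {n : ℕ} {x : Fin (n + 1) → X}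
    (h : ∀ i : Fin n, Adjacent (x i.castSucc) (x i.succ)) {i : ℕ} (hi : i < n) :
    Adjacent (toSeq x i) (toSeq x (i + 1)) := by
  rw [toSeq_of_le x (by omega), toSeq_of_le x (by omega)]
  exact h ⟨i, hi⟩

/-- The two neighbours of an inner entry coincide, so it is not between them: every entry is a
corner. -/
theorem Adjacent.length_remove_alternating_ne {a b : X} (h : Adjacent a b) {n : ℕ}
    (k : Fin (n + 2)) :
    length (remove (MagnitudeHomology.alternating a b (n + 1)) k) ≠
      length (MagnitudeHomology.alternating a b (n + 1)) := by
  have hp : IsProper (MagnitudeHomology.alternating a b (n + 1)) := fun i => (h.alternating i).1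
  intro hk
  obtain ⟨h0, h1, h2⟩ := not_corner_iff.1 ((hp.length_remove_eq_iff k).1 hk)
  obtain ⟨j, hj⟩ : ∃ j, (k : ℕ) = j + 1 := ⟨k - 1, by omega⟩
  rw [hj] at h1 h2
  rw [Nat.add_sub_cancel, toSeq_alternating _ _ (by omega), toSeq_alternating _ _ (by omega),
    toSeq_alternating _ _ (by omega)] at h2
  have hd := dist_pos.2 h.1
  have hd' := dist_comm a b
  simp only [Nat.even_add_one, not_not, Between] at h2
  by_cases he : Even j
  · simp only [he, if_true, not_true, if_false, dist_self] at h2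
    linarith
  · simp only [he, if_true, not_false_eq_true, if_false, dist_self] at h2
    linarith

theorem Adjacent.boundary_alternating {a b : X} (h : Adjacent a b) {n : ℕ} {ℓ : ℝ≥0}
    (x : ProperChain X (n + 1) ℓ) (hx : x.1 = MagnitudeHomology.alternating a b (n + 1)) :
    boundary X n ℓ (Finsupp.single x 1) = 0 := by
  rw [boundary_single, Finset.sum_eq_zero]
  intro k _
  rw [gen_of_length_ne, smul_zero]
  intro hk
  have hk' := hk.trans x.2.2.symm
  rw [hx] at hk'
  exact h.length_remove_alternating_ne k hk'

/-- A chain whose successive entries are adjacent does not occur in any boundary. -/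
theorem boundary_apply_of_adjacent {n : ℕ} {ℓ : ℝ≥0} (c : ProperChain X n ℓ)
    (h : ∀ i : Fin n, Adjacent (c.1 i.castSucc) (c.1 i.succ)) (w : MC X (n + 1) ℓ) :
    boundary X n ℓ w c = 0 := by
  classical
  suffices hl : Finsupp.lapply c ∘ₗ boundary X n ℓ = 0 from LinearMap.congr_fun hl w
  refine Finsupp.lhom_ext' fun x => LinearMap.ext_ring ?_
  simp only [LinearMap.comp_apply, Finsupp.lsingle_apply, LinearMap.zero_apply,
    Finsupp.lapply_apply]
  rw [boundary_single, Finset.sum_apply']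
  refine Finset.sum_eq_zero fun k _ => ?_
  rw [Finsupp.smul_apply]
  by_cases hk : length (remove x.1 k) = ℓ
  · rw [gen_eq_single (isProper_remove x.1 k x.2.1 (hk.trans x.2.2.symm)) hk,
      Finsupp.single_apply, if_neg, smul_zero]
    rintro rfl
    -- The removed entry would lie strictly between two successive entries of `c`, which are
    -- adjacent.
    obtain ⟨h0, h1, h2⟩ :=
      not_corner_iff.1 ((x.2.1.length_remove_eq_iff k).1 (hk.trans x.2.2.symm))
    have hu := (isProper_iff_properSeq x.1).1 x.2.1
    obtain ⟨j, hj⟩ : ∃ j, (k : ℕ) = j + 1 := ⟨k - 1, by omega⟩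
    have h3 := toSeq_adjacent h (by omega : j < n)
    dsimp only at h3
    rw [toSeq_remove x.1 k (by omega), hj, removeSeq_of_lt _ (by omega),
      removeSeq_of_le _ le_rfl] at h3
    rw [hj, Nat.add_sub_cancel] at h2
    exact h3.2 ⟨_, h2, hu j (by omega), hu (j + 1) (by omega)⟩
  · rw [gen_of_length_ne hk, Finsupp.zero_apply, smul_zero]

theorem MHMap_eq_id_iff (e : X → X) (he : IsMap e) (n : ℕ) :
    MHMap e he n = AddMonoidHom.id (MH X n) ↔
      ∀ ℓ, HomologicalComplex.homologyMap (magnitudeComplexMap e he ℓ) n =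
        𝟙 ((magnitudeComplex X ℓ).homology n) := by
  classical
  constructor
  · intro h ℓ
    ext c
    have h1 := congrArg (fun z => z ℓ)
      (DFunLike.congr_fun h (DirectSum.of (fun ℓ => MHl X n ℓ) ℓ c))
    simp only [MHMap, DirectSum.map_apply, AddMonoidHom.id_apply] at h1
    rwa [DirectSum.of_eq_same (β := fun ℓ => MHl X n ℓ) ℓ c] at h1
  · intro h
    refine DirectSum.addHom_ext fun ℓ c => ?_
    simp only [MHMap, DirectSum.map_of, MHlMap, h ℓ]
    rfl

/-- If a map of metric spaces moves each cycle by a boundary, then it induces the identity on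
homology. -/
theorem homologyMap_eq_id (e : X → X) (he : IsMap e) (n : ℕ) (ℓ : ℝ≥0)
    (h : ∀ z : MC X (n + 1) ℓ, boundary X n ℓ z = 0 →
      ∃ w, boundary X (n + 1) ℓ w = chainMap e (n + 1) ℓ z - z) :
    HomologicalComplex.homologyMap (magnitudeComplexMap e he ℓ) (n + 1) =
      𝟙 ((magnitudeComplex X ℓ).homology (n + 1)) := by
  let K := magnitudeComplex X ℓ
  rw [← cancel_epi (K.homologyπ (n + 1)), HomologicalComplex.homologyπ_naturality,
    Category.comp_id]
  ext c
  have hz : K.d (n + 1) n (K.iCycles (n + 1) c) = 0 := by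
    rw [← ModuleCat.comp_apply, HomologicalComplex.iCycles_d]
    rfl
  obtain ⟨w, hw⟩ : ∃ w : K.X (n + 2), K.d (n + 2) (n + 1) w =
      (magnitudeComplexMap e he ℓ).f (n + 1) (K.iCycles (n + 1) c) - K.iCycles (n + 1) c := by
    rw [magnitudeComplex_d] at hz ⊢
    exact h (K.iCycles (n + 1) c) hz
  -- The equation of chains lifts to cycles, whose inclusion is injective; `homologyπ` then kills
  -- its left side.
  have hw' : K.toCycles (n + 2) (n + 1) w =
      HomologicalComplex.cyclesMap (magnitudeComplexMap e he ℓ) (n + 1) c - c := by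
    apply (ModuleCat.mono_iff_injective (K.iCycles (n + 1))).1 inferInstance
    rw [map_sub, ← ModuleCat.comp_apply, ← ModuleCat.comp_apply, HomologicalComplex.toCycles_i,
      HomologicalComplex.cyclesMap_i]
    exact hw
  have h1 := congrArg (K.homologyπ (n + 1)) hw'
  rw [← ModuleCat.comp_apply, HomologicalComplex.toCycles_comp_homologyπ, map_sub] at h1
  exact (sub_eq_zero.1 h1.symm)

/-- A linear map which vanishes on boundaries agrees on cycles with the same homology class. -/
theorem apply_eq_of_homologyMap_eq_id (e : X → X) (he : IsMap e) (n : ℕ) (ℓ : ℝ≥0)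
    (h : HomologicalComplex.homologyMap (magnitudeComplexMap e he ℓ) (n + 1) =
      𝟙 ((magnitudeComplex X ℓ).homology (n + 1)))
    (z : MC X (n + 1) ℓ) (hz : boundary X n ℓ z = 0) (f : MC X (n + 1) ℓ →ₗ[ℤ] MC X (n + 1) ℓ)
    (hf : f ∘ₗ boundary X (n + 1) ℓ = 0) : f (chainMap e (n + 1) ℓ z) = f z := by
  let K := magnitudeComplex X ℓ
  let g : K.X (n + 1) ⟶ ModuleCat.of ℤ (MC X (n + 1) ℓ) := ModuleCat.ofHom f
  have hg : K.d (n + 2) (n + 1) ≫ g = 0 := by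
    rw [magnitudeComplex_d]
    exact congrArg ModuleCat.ofHom hf
  -- On cycles, `g` factors through homology, since it descends to the quotient by boundaries.
  have hι : K.homologyπ (n + 1) ≫ K.homologyι (n + 1) ≫
      K.descOpcycles g (n + 2) (by simp) hg = K.iCycles (n + 1) ≫ g := by
    rw [← Category.assoc, HomologicalComplex.homology_π_ι, Category.assoc,
      HomologicalComplex.p_descOpcycles]
  have h1 : K.iCycles (n + 1) ≫ (magnitudeComplexMap e he ℓ).f (n + 1) ≫ g =
      K.iCycles (n + 1) ≫ g := by
    rw [← Category.assoc, ← HomologicalComplex.cyclesMap_i, Category.assoc, ← hι,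
      ← Category.assoc, ← HomologicalComplex.homologyπ_naturality, h, Category.comp_id]
  -- Lifting the concrete kernel to the cycles object allows evaluation at `z`.
  let k : ModuleCat.of ℤ (LinearMap.ker (boundary X n ℓ)) ⟶ K.X (n + 1) :=
    ModuleCat.ofHom (LinearMap.ker (boundary X n ℓ)).subtype
  have hk : k ≫ K.d (n + 1) n = 0 := by
    rw [magnitudeComplex_d]
    ext c
    exact c.2
  have h2 := congrArg (fun φ => K.liftCycles k n (by simp) hk ≫ φ) h1
  simp only [HomologicalComplex.liftCycles_i_assoc] at h2
  exact congrArg (fun φ => φ ⟨z, hz⟩) h2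

/-- A map which induces the identity on homology in some positive degree fixes the inner
boundary. -/
theorem eq_of_homologyMap_eq_id (e : X → X) (he : IsMap e) (n : ℕ)
    (h : ∀ ℓ, HomologicalComplex.homologyMap (magnitudeComplexMap e he ℓ) (n + 1) =
      𝟙 ((magnitudeComplex X ℓ).homology (n + 1))) {a b : X} (hab : Adjacent a b) : e a = a := by
  classical
  let x := alternating a b (n + 1)
  obtain ⟨ℓ, hℓ⟩ : ∃ ℓ : ℝ≥0, length x = ℓ := ⟨⟨length x, length_nonneg x⟩, rfl⟩
  let c : ProperChain X (n + 1) ℓ := ⟨x, fun i => (hab.alternating i).1, hℓ⟩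
  -- This is the coefficient at `c`, recorded as a multiple of `c` so that it takes values in the
  -- chain group.
  have hf : (Finsupp.lsingle c ∘ₗ Finsupp.lapply c : MC X (n + 1) _ →ₗ[ℤ] MC X (n + 1) _) ∘ₗ
      boundary X (n + 1) _ = 0 := by
    ext1 w
    refine LinearMap.ext fun r => ?_
    simp only [LinearMap.comp_apply, Finsupp.lapply_apply,
      boundary_apply_of_adjacent c hab.alternating, map_zero, LinearMap.zero_apply]
  have h1 := apply_eq_of_homologyMap_eq_id e he n _ (h _) (Finsupp.single c 1)
    (hab.boundary_alternating c rfl) _ hf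
  have h2 : chainMap e (n + 1) _ (Finsupp.single c 1) c = 1 := by
    have := congrArg (fun z => z c) h1
    simpa using this
  rw [chainMap_single] at h2
  -- The image of `c` is a single generator or zero, so coefficient `1` at `c` forces `e ∘ c = c`.
  by_cases hp : IsProper (e ∘ c.1) ∧ length (e ∘ c.1) = ℓ
  · rw [gen_eq_single hp.1 hp.2, Finsupp.single_apply] at h2
    have h3 := by_contra fun h3 => zero_ne_one ((if_neg h3).symm.trans h2)
    have h4 := congrFun (congrArg Subtype.val h3) 0
    simpa [c, x, alternating] using h4
  · unfold gen at h2
    rw [dif_neg hp] at h2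
    simp at h2

end Homology

end MagnitudeHomology

theorem proposition6p5 {X : Type*} [MetricSpace X] (hX : MagnitudeHomology.IsAligned X)
    (e : X → X) (he : MagnitudeHomology.IsMap e) :
    List.TFAE [
      ∀ n : ℕ, 1 ≤ n →
        MagnitudeHomology.MHMap e he n = AddMonoidHom.id (MagnitudeHomology.MH X n),
      ∃ n : ℕ, 1 ≤ n ∧
        MagnitudeHomology.MHMap e he n = AddMonoidHom.id (MagnitudeHomology.MH X n),
      ∀ x ∈ MagnitudeHomology.innerBoundary X, e x = x] := by
  tfae_have 1 → 2 := fun h => ⟨1, le_rfl, h 1 le_rfl⟩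
  tfae_have 2 → 3 := by
    rintro ⟨n, hn, h⟩ x ⟨y, hxy⟩
    obtain ⟨n, rfl⟩ : ∃ k, n = k + 1 := ⟨n - 1, by omega⟩
    exact MagnitudeHomology.eq_of_homologyMap_eq_id e he n
      ((MagnitudeHomology.MHMap_eq_id_iff e he _).1 h) hxy
  tfae_have 3 → 1 := by
    intro h n hn
    obtain ⟨n, rfl⟩ : ∃ k, n = k + 1 := ⟨n - 1, by omega⟩
    exact (MagnitudeHomology.MHMap_eq_id_iff e he _).2 fun ℓ =>
      MagnitudeHomology.homologyMap_eq_id e he n ℓ fun z hz => hX.exists_boundary_eq he h z hz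
  tfae_finish
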